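/- Consider the Cramér–Lundberg risk model with premium rate $1$ and claims arriving according to a Poisson process with rate $\lambda>0$. The claim sizes are i.i.d. and independent of the arrivals; a claim is distributed as $B$ with probability $1-\epsilon$ and as $C$ with probability $\epsilon$, where $0<\epsilon\le 1$, $B$ has a phase-type distribution, and $C\ge 0$ has a finite mean $\mathbb E C>0$. Put $\delta=\lambda\,\mathbb E B$ and $\theta=\lambda\,\mathbb E C$, and assume the stability condition $(1-\epsilon)\delta+\epsilon\theta<1$. Let $C^e$ have the stationary excess distribution of $C$, i.e. $\mathbb P(C^e\le u)=\frac1{\mathbb E C}\int_0^u\mathbb P(C>t)\,dt$ for $u\ge 0$. Let $M^\bullet_\epsilon$ be the supremum over $t\ge 0$ of the claim surplus (claims up to time $t$ minus $t$) in the model in which the claims of type $C$ are discarded, i.e. in which a claim is distributed as $B$ with probability $1-\epsilon$ and is $0$ with probability $\epsilon$; this supremum is almost surely finite. The corrected discard approximation of the ruin probability with initial capital $u$ is $$\hat\psi_{d,\epsilon}(u)=\mathbb P(M^\bullet_\epsilon>u)+\frac{\epsilon\theta}{1-\delta+\epsilon\delta}\Big(\mathbb P(M^\bullet_{\epsilon,0}+M^\bullet_{\epsilon,1}+C^e>u)-\mathbb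 P(M^\bullet_{\epsilon,0}>u)\Big),$$ where $M^\bullet_{\epsilon,0}$, $M^\bullet_{\epsilon,1}$, $C^e$ are independent and $M^\bullet_{\epsilon,0}$, $M^\bullet_{\epsilon,1}$ are distributed as $M^\bullet_\epsilon$. If the distribution of $C^e$ is subexponential, that is, if for every $n\ge1$ the ratio of the tail at $u$ of its $n$-fold convolution to its own tail at $u$ tends to $n$ as $u\to\infty$, then $$\hat\psi_{d,\epsilon}(u)\;\sim\;\frac{\epsilon\theta}{1-\delta+\epsilon\delta}\,\mathbb P(C^e>u),\qquad u\to\infty,$$ where $\sim$ means that the ratio of the two sides tends to $1$. Moreover, the coefficient satisfies $$0<\frac{\epsilon\theta}{1-\delta+\epsilon\delta}<\frac{\epsilon\theta}{1-\delta+\epsilon\delta-\epsilon\theta}.$$ -/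

import Mathlib

open MeasureTheory ProbabilityTheory Filter Topology

noncomputable section

/-- `B` is a phase-type distribution: the law of the absorption time of a finite Markov jump
process with `m` transient states, initial (sub)probability vector `a` on the transient states
and nonsingular subintensity matrix `T`, i.e. `B(x, ∞) = a exp(xT) 1` for `x ≥ 0`.
If the entries of `a` sum to less than one, the missing mass is an atom at zero. -/
def IsPhaseType (B : Measure ℝ) : Prop :=
  IsProbabilityMeasure B ∧ B (Set.Iio 0) = 0 ∧
    ∃ (m : ℕ) (a : Fin m → ℝ) (T : Matrix (Fin m) (Fin m) ℝ),
      (∀ i, 0 ≤ a i) ∧ ∑ i, a i ≤ 1 ∧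
      (∀ i j, i ≠ j → 0 ≤ T i j) ∧ (∀ i, ∑ j, T i j ≤ 0) ∧ IsUnit T.det ∧
      ∀ x : ℝ, 0 ≤ x →
        B.real (Set.Ioi x) = dotProduct a (Matrix.mulVec (NormedSpace.exp (x • T)) (fun _ => 1))

/-- The stationary excess distribution of a distribution `F` on `[0, ∞)` with finite positive
mean `μ`: its density on `[0, ∞)` is `t ↦ F(t, ∞) / μ`. -/
def stationaryExcess (F : Measure ℝ) : Measure ℝ :=
  (volume.restrict (Set.Ici 0)).withDensity
    fun t => ENNReal.ofReal (F.real (Set.Ioi t) / ∫ x, x ∂F)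

/-- The `n`-fold convolution of `F` with itself (the unit mass at zero for `n = 0`). -/
def convPower (F : Measure ℝ) : ℕ → Measure ℝ
  | 0 => Measure.dirac 0
  | n + 1 => (convPower F n).conv F

/-- The class of subexponential distributions on `[0, ∞)`. -/
def IsSubexponential (F : Measure ℝ) : Prop :=
  IsProbabilityMeasure F ∧ F (Set.Iio 0) = 0 ∧
    ∀ n : ℕ, 1 ≤ n →
      Tendsto (fun u : ℝ => (convPower F n).real (Set.Ioi u) / F.real (Set.Ioi u))
        atTop (𝓝 (n : ℝ))

/-! ### The Cramér-Lundberg risk model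

An outcome `ω` lists, for each `i`, the waiting time `(ω i).1` between claims `i - 1` and `i`, and
the size `(ω i).2` of claim `i` (numbered from `i = 0`). -/

/-- Claims arrive according to a Poisson process of rate `lam` (i.i.d. exponential waiting
times), the claim sizes are i.i.d. with law `G`, independent of the arrivals. -/
def riskMeasure (lam : ℝ) (G : Measure ℝ) : Measure (ℕ → ℝ × ℝ) :=
  Measure.infinitePi fun _ => (expMeasure lam).prod G

/-- The number of claims that have arrived by time `t`. -/
def claimCount (ω : ℕ → ℝ × ℝ) (t : ℝ) : ℕ :=
  Set.ncard {n : ℕ | ∑ i ∈ Finset.range (n + 1), (ω i).1 ≤ t}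

/-- The claim surplus at time `t`, the premium rate being one: the claims up to time `t` minus
the premiums up to time `t`. -/
def claimSurplus (ω : ℕ → ℝ × ℝ) (t : ℝ) : ℝ :=
  ∑ i ∈ Finset.range (claimCount ω t), (ω i).2 - t

/-- The supremum over `t ≥ 0` of the claim surplus (used where it is almost surely finite). -/
def surplusSup (ω : ℕ → ℝ × ℝ) : ℝ :=
  ⨆ t : NNReal, claimSurplus ω (t : ℝ)

/-- The law of the supremum of the claim surplus process for arrival rate `lam` and claim size
distribution `G`. -/
def surplusSupLaw (lam : ℝ) (G : Measure ℝ) : Measure ℝ :=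
  (riskMeasure lam G).map surplusSup

/-- The claim size distribution of the model in which the heavy-tailed claims are discarded:
with probability `1 - eps` the claim has law `B`, with probability `eps` it is zero. -/
def discardClaim (eps : ℝ) (B : Measure ℝ) : Measure ℝ :=
  ENNReal.ofReal (1 - eps) • B + ENNReal.ofReal eps • Measure.dirac 0

/-- The discard approximation of the ruin probability with initial capital `u`. -/
def discardApprox (lam eps : ℝ) (B : Measure ℝ) (u : ℝ) : ℝ :=
  (surplusSupLaw lam (discardClaim eps B)).real (Set.Ioi u)

/-- The corrected discard approximation of the ruin probability with initial capital `u`, where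
phase-type claims have law `B`, heavy-tailed claims have law `C`, and
`δ = lam E[B]`, `θ = lam E[C]`:
`P(M₀ > u) + εθ / (1 - δ + εδ) * (P(M₀ + M₁ + Cᵉ > u) - P(M₀ > u))`
with `M₀`, `M₁`, `Cᵉ` independent and `M₀`, `M₁` distributed as the supremum of the claim surplus
in the model without the heavy-tailed claims. -/
def correctedDiscard (lam eps : ℝ) (B C : Measure ℝ) (u : ℝ) : ℝ :=
  let δ := lam * ∫ x, x ∂B
  let θ := lam * ∫ x, x ∂C
  let M := surplusSupLaw lam (discardClaim eps B)
  discardApprox lam eps B u +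
    eps * θ / (1 - δ + eps * δ) *
      (((M.conv M).conv (stationaryExcess C)).real (Set.Ioi u) - discardApprox lam eps B u)

end

/-!
The light-tailed part of the model stays light-tailed, and adding an independent nonnegative
light-tailed variable does not change a subexponential tail. Hence, in the corrected discard
approximation, only the term with `M₀ + M₁ + Cᵉ` contributes in the limit, and its tail is that of
`Cᵉ`.

*Light tails.* For a subintensity matrix `T` the vector `exp (x T) 1` decreases in `x`. Its limit is
fixed by the semigroup `exp (x T)`, hence killed by the nonsingular `T`, hence zero
(`Matrix.tendsto_exp_smul_mulVec_one`). By the semigroup property a phase-type tail decays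
geometrically, so it has a finite exponential moment (`IsPhaseType.exists_integrable_exp`). The
supremum of the claim surplus is the supremum of the random walk embedded at claim times
(`surplusSup_eq_iSup_surplusWalk`). The steps of this walk have negative mean by the stability
condition, so some `γ > 0` satisfies `E exp (γ (X - W)) < 1` for a claim `X` and a waiting time `W`.
Bounding the exponential of the supremum `M` by the sum over all claims gives
`E exp (γ M) ≤ ∑ₙ (E exp (γ (X - W))) ^ n < ∞`. Hence the supremum is almost surely finite
(`bddAbove_claimSurplus`) and light-tailed (`integrable_exp_surplusSupLaw`).

*Heavy tails.* A subexponential law `F` is long-tailed: `F (u - y, ∞) / F (u, ∞) → 1`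
(`IsSubexponential.tendsto_shift`). Iterating over unit steps bounds this ratio by `K exp (γ y)`
uniformly in `u`, for every `γ > 0` (`IsSubexponential.exists_tail_le`). If `H` has a
finite exponential moment, dominated convergence applies to
`(H ∗ F) (u, ∞) / F (u, ∞) = ∫ F (u - y, ∞) / F (u, ∞) dH(y)`, so the ratio tends to one
(`IsSubexponential.tendsto_conv_light`). The same bound shows that the tail of `H` itself is negligible (`IsSubexponential.tendsto_light_div`).
-/

/-! ### Exponentials of subintensity matrices -/

lemma Matrix.mul_entry_nonneg {m : ℕ} {A B : Matrix (Fin m) (Fin m) ℝ}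
    (hA : ∀ i j, 0 ≤ A i j) (hB : ∀ i j, 0 ≤ B i j) (i j : Fin m) : 0 ≤ (A * B) i j := by
  rw [Matrix.mul_apply]
  exact Finset.sum_nonneg fun k _ => mul_nonneg (hA i k) (hB k j)

section MatrixExponential

attribute [local instance] Matrix.linftyOpNormedRing Matrix.linftyOpNormedAlgebra

lemma Matrix.hasDerivAt_exp_smul_mulVec {m : ℕ} (T : Matrix (Fin m) (Fin m) ℝ) (v : Fin m → ℝ)
    (x : ℝ) :
    HasDerivAt (fun y : ℝ => Matrix.mulVec (NormedSpace.exp (y • T)) v)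
      (Matrix.mulVec (NormedSpace.exp (x • T)) (Matrix.mulVec T v)) x := by
  have h := hasDerivAt_exp_smul_const (𝕂 := ℝ) T x
  let L : Matrix (Fin m) (Fin m) ℝ →ₗ[ℝ] (Fin m → ℝ) :=
    { toFun := fun A => Matrix.mulVec A v
      map_add' := fun A B => Matrix.add_mulVec A B v
      map_smul' := fun c A => Matrix.smul_mulVec c A v }
  have h2 := (LinearMap.toContinuousLinearMap L).hasFDerivAt.comp_hasDerivAt x h
  rw [Matrix.mulVec_mulVec]
  exact h2

lemma Matrix.exp_entry_nonneg_of_entry_nonneg {m : ℕ} {N : Matrix (Fin m) (Fin m) ℝ}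
    (hN : ∀ i j, 0 ≤ N i j) (i j : Fin m) : 0 ≤ (NormedSpace.exp N) i j := by
  have h := NormedSpace.exp_series_hasSum_exp' (𝕂 := ℝ) N
  have h2 : HasSum (fun n : ℕ => ((n.factorial⁻¹ : ℝ) • N ^ n) i j) (NormedSpace.exp N i j) :=
    Pi.hasSum.1 (Pi.hasSum.1 h i) j
  refine h2.nonneg fun n => ?_
  have hp : ∀ n : ℕ, ∀ i j, 0 ≤ (N ^ n) i j := by
    intro n
    induction n with
    | zero => intro i j; rw [pow_zero, Matrix.one_apply]; split_ifs <;> norm_num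
    | succ k ih => rw [pow_succ]; exact Matrix.mul_entry_nonneg ih hN
  rw [Matrix.smul_apply, smul_eq_mul]
  exact mul_nonneg (by positivity) (hp n i j)

end MatrixExponential

/-- The exponential of a Metzler matrix has nonnegative entries: a shift by a multiple of the
identity makes the matrix itself nonnegative and multiplies the exponential by a positive scalar. -/
lemma Matrix.exp_entry_nonneg {m : ℕ} {T : Matrix (Fin m) (Fin m) ℝ}
    (hT : ∀ i j, i ≠ j → 0 ≤ T i j) (i j : Fin m) : 0 ≤ (NormedSpace.exp T) i j := by
  set c : ℝ := ∑ k, |T k k| with hc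
  set D : Matrix (Fin m) (Fin m) ℝ := Matrix.diagonal fun _ => -c with hD
  have hsum : T = (T - D) + D := by simp
  have hcomm : Commute (T - D) D := by
    refine Commute.sub_left ?_ (Commute.refl _)
    have : D = Matrix.scalar (Fin m) (-c) := rfl
    rw [this]
    exact (Matrix.scalar_commute _ (fun r => Commute.all _ r) T).symm
  rw [hsum, Matrix.exp_add_of_commute _ _ hcomm]
  refine Matrix.mul_entry_nonneg (Matrix.exp_entry_nonneg_of_entry_nonneg fun i j => ?_) ?_ i j
  · rw [Matrix.sub_apply, hD, Matrix.diagonal_apply]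
    split_ifs with h
    · subst h
      have : |T i i| ≤ c := Finset.single_le_sum (f := fun k => |T k k|)
        (fun _ _ => abs_nonneg _) (Finset.mem_univ i)
      linarith [neg_abs_le (T i i)]
    · simpa using hT i j h
  · intro i j
    rw [hD, Matrix.exp_diagonal, Matrix.diagonal_apply, Pi.coe_exp, ← Real.exp_eq_exp_ℝ]
    split_ifs
    · exact (Real.exp_pos _).le
    · exact le_rfl

section Subintensity

variable {m : ℕ} {T : Matrix (Fin m) (Fin m) ℝ}

lemma Matrix.exp_add_smul_mulVec (T : Matrix (Fin m) (Fin m) ℝ) (x y : ℝ) (v : Fin m → ℝ) :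
    Matrix.mulVec (NormedSpace.exp ((x + y) • T)) v =
      Matrix.mulVec (NormedSpace.exp (x • T)) (Matrix.mulVec (NormedSpace.exp (y • T)) v) := by
  rw [add_smul, Matrix.exp_add_of_commute _ _
    (((Commute.refl T).smul_left x).smul_right y), Matrix.mulVec_mulVec]

lemma Matrix.mulVec_mono_of_entry_nonneg {A : Matrix (Fin m) (Fin m) ℝ} (hA : ∀ i j, 0 ≤ A i j)
    {v w : Fin m → ℝ} (h : v ≤ w) : Matrix.mulVec A v ≤ Matrix.mulVec A w := by
  intro i
  simp only [Matrix.mulVec, dotProduct]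
  exact Finset.sum_le_sum fun j _ => mul_le_mul_of_nonneg_left (h j) (hA i j)

lemma Matrix.exp_smul_entry_nonneg (hT : ∀ i j, i ≠ j → 0 ≤ T i j) {x : ℝ} (hx : 0 ≤ x)
    (i j : Fin m) : 0 ≤ (NormedSpace.exp (x • T)) i j :=
  Matrix.exp_entry_nonneg (fun i j h => mul_nonneg hx (hT i j h)) i j

/-- The survival probabilities `exp (x T) 1` of a subintensity matrix decrease in `x`. -/
lemma Matrix.antitoneOn_exp_smul_mulVec_one (hT : ∀ i j, i ≠ j → 0 ≤ T i j)
    (hrow : ∀ i, ∑ j, T i j ≤ 0) :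
    AntitoneOn (fun x : ℝ => Matrix.mulVec (NormedSpace.exp (x • T)) fun _ => 1) (Set.Ici 0) := by
  have key (i : Fin m) : AntitoneOn
      (fun x : ℝ => Matrix.mulVec (NormedSpace.exp (x • T)) (fun _ => 1) i) (Set.Ici 0) := by
    have hd (x : ℝ) := hasDerivAt_pi.1 (Matrix.hasDerivAt_exp_smul_mulVec T (fun _ => 1) x) i
    refine antitoneOn_of_hasDerivWithinAt_nonpos (convex_Ici 0)
      (fun x _ => (hd x).continuousAt.continuousWithinAt)
      (fun x _ => (hd x).hasDerivWithinAt) fun x hx => ?_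
    rw [interior_Ici] at hx
    have := Matrix.mulVec_mono_of_entry_nonneg (Matrix.exp_smul_entry_nonneg hT hx.le)
      (v := Matrix.mulVec T fun _ => 1) (w := 0)
      (fun i => by simpa [Matrix.mulVec, dotProduct] using hrow i) i
    simpa using this
  exact fun x hx y hy hxy i => key i hx hy hxy

/-- Absorption is certain: the limit of the survival probabilities is a fixed point of the
semigroup, so it lies in the kernel of `T`, which is trivial. -/
lemma Matrix.tendsto_exp_smul_mulVec_one (hT : ∀ i j, i ≠ j → 0 ≤ T i j)
    (hrow : ∀ i, ∑ j, T i j ≤ 0) (hdet : IsUnit T.det) :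
    Tendsto (fun x : NNReal => Matrix.mulVec (NormedSpace.exp ((x : ℝ) • T)) fun _ => 1)
      atTop (𝓝 0) := by
  set f : NNReal → Fin m → ℝ :=
    fun x => Matrix.mulVec (NormedSpace.exp ((x : ℝ) • T)) fun _ => 1 with hf
  have hanti : Antitone f := fun x y hxy =>
    Matrix.antitoneOn_exp_smul_mulVec_one hT hrow x.2 y.2 hxy
  have hnn (x : NNReal) : 0 ≤ f x := by
    have := Matrix.mulVec_mono_of_entry_nonneg (Matrix.exp_smul_entry_nonneg hT x.2)
      (v := 0) (w := fun _ => 1) fun _ => zero_le_one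
    rwa [Matrix.mulVec_zero] at this
  set v : Fin m → ℝ := fun i => ⨅ x, f x i with hv
  have hlim : Tendsto f atTop (𝓝 v) := by
    rw [tendsto_pi_nhds]
    exact fun i => tendsto_atTop_ciInf (fun x y h => hanti h i)
      ⟨0, by rintro _ ⟨x, rfl⟩; exact hnn x i⟩
  have hfix (y : ℝ) (hy : y ∈ Set.Ici (0 : ℝ)) :
      Matrix.mulVec (NormedSpace.exp (y • T)) v = v := by
    lift y to NNReal using hy
    have h1 : Tendsto (fun x => Matrix.mulVec (NormedSpace.exp ((y : ℝ) • T)) (f x)) atTop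
        (𝓝 (Matrix.mulVec (NormedSpace.exp ((y : ℝ) • T)) v)) :=
      ((Continuous.matrix_mulVec continuous_const continuous_id).tendsto v).comp hlim
    have h2 : Tendsto (fun x => f (y + x)) atTop (𝓝 v) :=
      hlim.comp (tendsto_atTop_mono (fun x => le_add_self) tendsto_id)
    refine tendsto_nhds_unique h1 (h2.congr fun x => ?_)
    simp only [hf, NNReal.coe_add]
    exact Matrix.exp_add_smul_mulVec T y x _
  have hTv : Matrix.mulVec T v = 0 := by
    have h1 := (Matrix.hasDerivAt_exp_smul_mulVec T v 0).hasDerivWithinAt (s := Set.Ici 0)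
    have h2 : HasDerivWithinAt (fun y : ℝ => Matrix.mulVec (NormedSpace.exp (y • T)) v) 0
        (Set.Ici 0) 0 :=
      (hasDerivWithinAt_const 0 (Set.Ici 0) v).congr hfix (hfix 0 Set.self_mem_Ici)
    have := (uniqueDiffOn_Ici (0 : ℝ) 0 Set.self_mem_Ici).eq_deriv _ h1 h2
    simpa [NormedSpace.exp_zero] using this
  have hv0 : v = 0 := Matrix.mulVec_injective_of_isUnit
    ((Matrix.isUnit_iff_isUnit_det T).2 hdet) (by rw [hTv, Matrix.mulVec_zero])
  rwa [hv0] at hlim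

end Subintensity

/-! ### Phase-type distributions and exponential moments -/

/-- The tail of a phase-type distribution decays geometrically along some arithmetic progression. -/
lemma IsPhaseType.exists_geometric_tail {B : Measure ℝ} (hB : IsPhaseType B) :
    ∃ x r : ℝ, 0 < x ∧ 0 < r ∧ r < 1 ∧ ∀ n : ℕ, B.real (Set.Ioi (n * x)) ≤ r ^ n := by
  obtain ⟨-, -, m, a, T, ha, ha1, hT, hrow, hdet, htail⟩ := hB
  have hlim := Matrix.tendsto_exp_smul_mulVec_one hT hrow hdet
  have hev : ∀ᶠ x : NNReal in atTop, ∀ i,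
      Matrix.mulVec (NormedSpace.exp ((x : ℝ) • T)) (fun _ => 1) i < 1 / 2 :=
    eventually_all.2 fun i => (tendsto_pi_nhds.1 hlim i).eventually_lt_const (by norm_num)
  obtain ⟨x, hx, hx0⟩ := (hev.and (eventually_gt_atTop 0)).exists
  refine ⟨x, 1 / 2, hx0, by norm_num, by norm_num, fun n => ?_⟩
  have hn : ∀ n : ℕ, Matrix.mulVec (NormedSpace.exp (((n : ℝ) * x) • T)) (fun _ => 1) ≤
      fun _ => (1 / 2 : ℝ) ^ n := by
    intro n
    induction n with
    | zero => simp [NormedSpace.exp_zero]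
    | succ k ih =>
      have h1 : ((k + 1 : ℕ) : ℝ) * x = k * x + x := by push_cast; ring
      have hkx : (0 : ℝ) ≤ k * x := by positivity
      rw [h1, Matrix.exp_add_smul_mulVec]
      refine (Matrix.mulVec_mono_of_entry_nonneg (Matrix.exp_smul_entry_nonneg hT hkx)
        (w := (1 / 2 : ℝ) • fun _ => 1) fun i => ?_).trans ?_
      · simpa using (hx i).le
      · rw [Matrix.mulVec_smul]
        intro i
        have := ih i
        simp only [Pi.smul_apply, smul_eq_mul, pow_succ] at this ⊢
        linarith
  rw [htail _ (by positivity)]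
  calc dotProduct a _ ≤ dotProduct a fun _ => (1 / 2 : ℝ) ^ n :=
        Finset.sum_le_sum fun i _ => mul_le_mul_of_nonneg_left (hn n i) (ha i)
    _ = (∑ i, a i) * (1 / 2) ^ n := by simp [dotProduct, Finset.sum_mul]
    _ ≤ 1 * (1 / 2) ^ n := by gcongr
    _ = (1 / 2) ^ n := one_mul _

lemma exp_mul_le_tsum_indicator {s x₀ : ℝ} (hs : 0 ≤ s) (hx₀ : 0 < x₀) {x : ℝ} (hx : 0 ≤ x) :
    ENNReal.ofReal (Real.exp (s * x)) ≤ 1 + ∑' n : ℕ, (Set.Ioi (n * x₀)).indicator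
      (fun _ => ENNReal.ofReal (Real.exp (s * ((n + 1) * x₀)))) x := by
  rcases hx.eq_or_lt with rfl | hx
  · simp
  · obtain ⟨n, hn⟩ : ∃ n : ℕ, ⌈x / x₀⌉₊ = n + 1 :=
      ⟨_, (Nat.succ_pred_eq_of_pos (Nat.ceil_pos.2 (div_pos hx hx₀))).symm⟩
    have h1 : x ≤ (n + 1) * x₀ := by
      have := Nat.le_ceil (x / x₀)
      rw [hn] at this
      push_cast at this
      exact (div_le_iff₀ hx₀).1 this
    have h2 : n * x₀ < x := by
      have : (n : ℝ) < x / x₀ := Nat.lt_ceil.1 (by omega)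
      exact (lt_div_iff₀ hx₀).1 this
    refine le_add_left (le_trans ?_ (ENNReal.le_tsum n))
    rw [Set.indicator_of_mem (Set.mem_Ioi.2 h2)]
    gcongr

/-- Phase-type distributions are light-tailed. -/
lemma IsPhaseType.exists_integrable_exp {B : Measure ℝ} (hB : IsPhaseType B) :
    ∃ s : ℝ, 0 < s ∧ Integrable (fun x => Real.exp (s * x)) B := by
  have : IsProbabilityMeasure B := hB.1
  obtain ⟨x₀, r, hx₀, hr, hr1, htail⟩ := hB.exists_geometric_tail
  have hlog : Real.log r < 0 := Real.log_neg hr hr1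
  -- With this exponent `exp (s x₀) = r ^ (-1/2)`, so the geometric tail wins.
  set s : ℝ := -Real.log r / (2 * x₀) with hs
  have hs0 : 0 < s := div_pos (by linarith) (by positivity)
  have hsx : s * x₀ = -Real.log r / 2 := by rw [hs]; field_simp
  refine ⟨s, hs0, ⟨by fun_prop, ?_⟩⟩
  rw [hasFiniteIntegral_iff_ofReal (Eventually.of_forall fun x => (Real.exp_pos _).le)]
  have hnn : ∀ᵐ x ∂B, 0 ≤ x := by
    rw [ae_iff]; simpa [not_le, Set.Iio] using hB.2.1
  have hterm (n : ℕ) : ENNReal.ofReal (Real.exp (s * ((n + 1) * x₀))) * B (Set.Ioi (n * x₀)) ≤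
      ENNReal.ofReal (Real.exp (s * x₀) * Real.exp (Real.log r / 2) ^ n) := by
    rw [← ofReal_measureReal, ← ENNReal.ofReal_mul (Real.exp_pos _).le]
    refine ENNReal.ofReal_le_ofReal ?_
    calc Real.exp (s * ((n + 1) * x₀)) * B.real (Set.Ioi (n * x₀))
        ≤ Real.exp (s * ((n + 1) * x₀)) * r ^ n := by gcongr; exact htail n
      _ = Real.exp (s * x₀) * Real.exp (Real.log r / 2) ^ n := by
        have hpow : r ^ n = Real.exp (n * Real.log r) := by
          rw [Real.exp_nat_mul, Real.exp_log hr]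
        rw [hpow, ← Real.exp_nat_mul, ← Real.exp_add, ← Real.exp_add]
        congr 1
        linear_combination (n : ℝ) * hsx
  calc ∫⁻ x, ENNReal.ofReal (Real.exp (s * x)) ∂B
      ≤ ∫⁻ x, (1 + ∑' n : ℕ, (Set.Ioi (n * x₀)).indicator
          (fun _ => ENNReal.ofReal (Real.exp (s * ((n + 1) * x₀)))) x) ∂B :=
        lintegral_mono_ae (hnn.mono fun x hx => exp_mul_le_tsum_indicator hs0.le hx₀ hx)
    _ = 1 + ∑' n : ℕ, ENNReal.ofReal (Real.exp (s * ((n + 1) * x₀))) * B (Set.Ioi (n * x₀)) := by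
        rw [lintegral_add_left measurable_const, lintegral_tsum
          fun n => (measurable_const.indicator measurableSet_Ioi).aemeasurable]
        simp
    _ ≤ 1 + ∑' n : ℕ, ENNReal.ofReal (Real.exp (s * x₀) * Real.exp (Real.log r / 2) ^ n) := by
        gcongr with n
        exact hterm n
    _ < ⊤ := by
        refine ENNReal.add_lt_top.2 ⟨ENNReal.one_lt_top, ?_⟩
        have hsum : Summable fun n : ℕ => Real.exp (s * x₀) * Real.exp (Real.log r / 2) ^ n :=
          (summable_geometric_of_lt_one (Real.exp_pos _).le
            (Real.exp_lt_one_iff.2 (by linarith))).mul_left _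
        rw [← ENNReal.ofReal_tsum_of_nonneg (fun n => by positivity) hsum]
        exact ENNReal.ofReal_lt_top

/-- If a light-tailed distribution has mean less than `c`, its moment generating function lies
strictly below `1 + c γ` for some `γ > 0`. -/
lemma exists_integral_exp_lt {G : Measure ℝ} [IsProbabilityMeasure G] (hG : ∀ᵐ x ∂G, 0 ≤ x)
    {s c : ℝ} (hs : 0 < s) (hint : Integrable (fun x => Real.exp (s * x)) G)
    (hc : ∫ x, x ∂G < c) :
    ∃ γ : ℝ, 0 < γ ∧ Integrable (fun x => Real.exp (γ * x)) G ∧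
      ∫ x, Real.exp (γ * x) ∂G < 1 + c * γ := by
  have hmem (t : ℝ) (ht : t < s) : t ∈ integrableExpSet id G := by
    refine hint.mono' (by fun_prop) (hG.mono fun x hx => ?_)
    rw [Real.norm_eq_abs, abs_of_pos (Real.exp_pos _)]
    exact Real.exp_le_exp.2 (mul_le_mul_of_nonneg_right ht.le hx)
  have h0 : (0 : ℝ) ∈ interior (integrableExpSet id G) :=
    mem_interior.2 ⟨Set.Iio s, hmem, isOpen_Iio, hs⟩
  have hd : HasDerivAt (mgf id G) (∫ x, x ∂G) 0 := by
    simpa using hasDerivAt_mgf h0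
  have hslope := (hasDerivAt_iff_tendsto_slope.1 hd).eventually_lt_const hc
  have hslope' := hslope.filter_mono
    (nhdsWithin_mono 0 fun x (hx : 0 < x) => hx.ne' : 𝓝[>] (0 : ℝ) ≤ _)
  obtain ⟨γ, hγ, hγs⟩ := (hslope'.and (Ioo_mem_nhdsGT hs)).exists
  refine ⟨γ, hγs.1, hmem γ hγs.2, ?_⟩
  rw [slope_def_field, mgf_zero, sub_zero, div_lt_iff₀ hγs.1] at hγ
  have : mgf id G γ = ∫ x, Real.exp (γ * x) ∂G := rfl
  linarith

/-! ### Claim sizes and waiting times -/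

section DiscardClaim

variable {eps : ℝ} {B : Measure ℝ}

lemma isProbabilityMeasure_discardClaim [IsProbabilityMeasure B] (h0 : 0 ≤ eps) (h1 : eps ≤ 1) :
    IsProbabilityMeasure (discardClaim eps B) := by
  constructor
  simp only [discardClaim, Measure.add_apply, Measure.smul_apply, measure_univ, smul_eq_mul,
    mul_one]
  rw [← ENNReal.ofReal_add (by linarith) h0]
  simp

lemma discardClaim_nonneg (hB : B (Set.Iio 0) = 0) : ∀ᵐ x ∂discardClaim eps B, 0 ≤ x := by
  rw [ae_iff]
  simp only [not_le]
  change discardClaim eps B (Set.Iio 0) = 0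
  simp [discardClaim, hB]

lemma integrable_discardClaim {f : ℝ → ℝ} (hf : Integrable f B) :
    Integrable f (discardClaim eps B) :=
  (hf.smul_measure ENNReal.ofReal_ne_top).add_measure
    ((integrable_dirac (by simp)).smul_measure ENNReal.ofReal_ne_top)

lemma integral_discardClaim {f : ℝ → ℝ} (hf : Integrable f B) (h0 : 0 ≤ eps) (h1 : eps ≤ 1) :
    ∫ x, f x ∂discardClaim eps B = (1 - eps) * ∫ x, f x ∂B + eps * f 0 := by
  rw [discardClaim, integral_add_measure (hf.smul_measure ENNReal.ofReal_ne_top)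
    ((integrable_dirac (by simp)).smul_measure ENNReal.ofReal_ne_top), integral_smul_measure,
    integral_smul_measure, integral_dirac, ENNReal.toReal_ofReal (by linarith),
    ENNReal.toReal_ofReal h0]
  rfl

end DiscardClaim

section ExponentialLaw

variable {lam : ℝ}

lemma expMeasure_pos (hlam : 0 < lam) : ∀ᵐ x ∂expMeasure lam, 0 < x := by
  have := isProbabilityMeasure_expMeasure hlam
  have h := cdf_expMeasure_eq hlam 0
  rw [cdf_eq_real] at h
  rw [ae_iff]
  simp only [not_lt]
  change expMeasure lam (Set.Iic 0) = 0
  rw [← measureReal_eq_zero_iff, h]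
  simp

/-- The Laplace transform of the exponential distribution. -/
lemma lintegral_exp_neg_expMeasure (hlam : 0 < lam) {γ : ℝ} (hγ : 0 ≤ γ) :
    ∫⁻ x, ENNReal.ofReal (Real.exp (-(γ * x))) ∂expMeasure lam =
      ENNReal.ofReal (lam / (lam + γ)) := by
  have hm (r : ℝ) : Measurable (exponentialPDF r) :=
    (measurable_exponentialPDFReal r).ennreal_ofReal
  change ∫⁻ x, _ ∂(volume.withDensity (exponentialPDF lam)) = _
  rw [lintegral_withDensity_eq_lintegral_mul _ (hm lam) (by fun_prop)]
  -- Tilting the density of rate `lam` gives a multiple of the density of rate `lam + γ`.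
  have key (x : ℝ) : (exponentialPDF lam * fun x => ENNReal.ofReal (Real.exp (-(γ * x)))) x =
      ENNReal.ofReal (lam / (lam + γ)) * exponentialPDF (lam + γ) x := by
    rw [Pi.mul_apply, exponentialPDF_eq, exponentialPDF_eq,
      ← ENNReal.ofReal_mul' (Real.exp_pos _).le,
      ← ENNReal.ofReal_mul (by positivity)]
    congr 1
    split_ifs
    · have : lam + γ ≠ 0 := by positivity
      rw [mul_assoc, ← Real.exp_add]
      field_simp
      ring_nf
    · simp
  simp_rw [key]
  rw [lintegral_const_mul _ (hm _), lintegral_exponentialPDF_eq_one (by positivity), mul_one]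

end ExponentialLaw

/-! ### The supremum of the claim surplus -/

/-- The claim surplus immediately after the first `n` claims. -/
def surplusWalk (ω : ℕ → ℝ × ℝ) (n : ℕ) : ℝ :=
  ∑ i ∈ Finset.range n, ((ω i).2 - (ω i).1)

section Path

variable {ω : ℕ → ℝ × ℝ}

lemma strictMono_arrival (hω : ∀ i, 0 < (ω i).1) :
    StrictMono fun n => ∑ i ∈ Finset.range n, (ω i).1 :=
  strictMono_nat_of_lt_succ fun n => by
    rw [Finset.sum_range_succ]
    exact lt_add_of_pos_right _ (hω n)

lemma claimCount_arrival (hω : ∀ i, 0 < (ω i).1) (n : ℕ) :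
    claimCount ω (∑ i ∈ Finset.range n, (ω i).1) = n := by
  have : {k : ℕ | ∑ i ∈ Finset.range (k + 1), (ω i).1 ≤ ∑ i ∈ Finset.range n, (ω i).1} =
      (Finset.range n : Set ℕ) := by
    ext k
    have := (strictMono_arrival hω).le_iff_le (a := k + 1) (b := n)
    simpa [Nat.succ_le_iff] using this
  rw [claimCount, this, Set.ncard_coe_finset, Finset.card_range]

/-- This holds even if infinitely many claims arrive by time `t`, as `claimCount` is then zero. -/
lemma arrival_claimCount_le (hω : ∀ i, 0 < (ω i).1) {t : ℝ} (ht : 0 ≤ t) :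
    ∑ i ∈ Finset.range (claimCount ω t), (ω i).1 ≤ t := by
  by_contra! h
  have hsub : {k : ℕ | ∑ i ∈ Finset.range (k + 1), (ω i).1 ≤ t} ⊆
      (Finset.range (claimCount ω t - 1) : Set ℕ) := fun k (hk : _ ≤ t) => by
    have := (strictMono_arrival hω).lt_iff_lt.1 (hk.trans_lt h)
    simp only [Finset.coe_range, Set.mem_Iio]
    omega
  have hle := Set.ncard_le_ncard hsub (Finset.finite_toSet _)
  rw [Set.ncard_coe_finset, Finset.card_range] at hle
  change claimCount ω t ≤ _ at hle
  have h0 : claimCount ω t = 0 := by omega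
  rw [h0, Finset.sum_range_zero] at h
  linarith

lemma claimSurplus_le_surplusWalk (hω : ∀ i, 0 < (ω i).1) {t : ℝ} (ht : 0 ≤ t) :
    claimSurplus ω t ≤ surplusWalk ω (claimCount ω t) := by
  rw [claimSurplus, surplusWalk, Finset.sum_sub_distrib]
  linarith [arrival_claimCount_le hω ht]

lemma claimSurplus_arrival (hω : ∀ i, 0 < (ω i).1) (n : ℕ) :
    claimSurplus ω (∑ i ∈ Finset.range n, (ω i).1) = surplusWalk ω n := by
  rw [claimSurplus, claimCount_arrival hω, surplusWalk, Finset.sum_sub_distrib]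

/-- The surplus decreases between claims, so its supremum is the supremum of the embedded random
walk. -/
lemma surplusSup_eq_iSup_surplusWalk (hω : ∀ i, 0 < (ω i).1) :
    surplusSup ω = ⨆ n, surplusWalk ω n := by
  refine csSup_eq_csSup_of_forall_exists_le ?_ ?_
  · rintro _ ⟨t, rfl⟩
    exact ⟨_, ⟨_, rfl⟩, claimSurplus_le_surplusWalk hω t.2⟩
  · rintro _ ⟨n, rfl⟩
    exact ⟨_, ⟨⟨∑ i ∈ Finset.range n, (ω i).1, Finset.sum_nonneg fun i _ => (hω i).le⟩, rfl⟩,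
      (claimSurplus_arrival hω n).ge⟩

lemma surplusWalk_le_of_tsum_ne_top {γ : ℝ} (hγ : 0 < γ)
    (h : ∑' n, ENNReal.ofReal (Real.exp (γ * surplusWalk ω n)) ≠ ⊤) (n : ℕ) :
    surplusWalk ω n ≤
      Real.log (∑' n, ENNReal.ofReal (Real.exp (γ * surplusWalk ω n))).toReal / γ := by
  have h1 := ENNReal.toReal_mono h
    (ENNReal.le_tsum (f := fun n => ENNReal.ofReal (Real.exp (γ * surplusWalk ω n))) n)
  rw [ENNReal.toReal_ofReal (Real.exp_pos _).le] at h1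
  rw [le_div_iff₀ hγ, mul_comm, Real.le_log_iff_exp_le ((Real.exp_pos _).trans_le h1)]
  exact h1

lemma exp_iSup_surplusWalk_le {γ : ℝ} (hγ : 0 < γ) :
    ENNReal.ofReal (Real.exp (γ * ⨆ n, surplusWalk ω n)) ≤
      ∑' n, ENNReal.ofReal (Real.exp (γ * surplusWalk ω n)) := by
  by_cases h : ∑' n, ENNReal.ofReal (Real.exp (γ * surplusWalk ω n)) = ⊤
  · rw [h]
    exact le_top
  · have h0 := ENNReal.toReal_mono h
      (ENNReal.le_tsum (f := fun n => ENNReal.ofReal (Real.exp (γ * surplusWalk ω n))) 0)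
    rw [ENNReal.toReal_ofReal (Real.exp_pos _).le] at h0
    rw [ENNReal.ofReal_le_iff_le_toReal h,
      ← Real.le_log_iff_exp_le ((Real.exp_pos _).trans_le h0), mul_comm, ← le_div_iff₀ hγ]
    exact ciSup_le (surplusWalk_le_of_tsum_ne_top hγ h)

/-- If the supremum is infinite, the real `⨆` is zero. -/
lemma iSup_surplusWalk_nonneg : 0 ≤ ⨆ n, surplusWalk ω n := by
  by_cases h : BddAbove (Set.range (surplusWalk ω))
  · exact (Finset.sum_range_zero _).ge.trans (le_ciSup h 0)
  · rw [Real.iSup_of_not_bddAbove h]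

end Path

section RiskModel

variable {lam : ℝ} {G : Measure ℝ}

lemma measurable_surplusWalk (n : ℕ) : Measurable fun ω => surplusWalk ω n := by
  unfold surplusWalk
  fun_prop

lemma ae_waiting_pos [IsProbabilityMeasure G] (hlam : 0 < lam) :
    ∀ᵐ ω ∂riskMeasure lam G, ∀ i, 0 < (ω i).1 := by
  have := isProbabilityMeasure_expMeasure hlam
  rw [ae_all_iff]
  intro i
  have h1 : ∀ᵐ p ∂(expMeasure lam).prod G, 0 < p.1 :=
    Measure.quasiMeasurePreserving_fst.ae (expMeasure_pos hlam)
  exact (measurePreserving_eval_infinitePi (fun _ : ℕ => (expMeasure lam).prod G)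
    i).quasiMeasurePreserving.ae h1

lemma aemeasurable_surplusSup [IsProbabilityMeasure G] (hlam : 0 < lam) :
    AEMeasurable surplusSup (riskMeasure lam G) :=
  ⟨fun ω => ⨆ n, surplusWalk ω n, Measurable.iSup measurable_surplusWalk,
    (ae_waiting_pos hlam).mono fun _ hω => surplusSup_eq_iSup_surplusWalk hω⟩

lemma isProbabilityMeasure_riskMeasure [IsProbabilityMeasure G] (hlam : 0 < lam) :
    IsProbabilityMeasure (riskMeasure lam G) := by
  have := isProbabilityMeasure_expMeasure hlam
  unfold riskMeasure
  infer_instance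

lemma isProbabilityMeasure_surplusSupLaw [IsProbabilityMeasure G] (hlam : 0 < lam) :
    IsProbabilityMeasure (surplusSupLaw lam G) := by
  have := isProbabilityMeasure_riskMeasure (G := G) hlam
  exact Measure.isProbabilityMeasure_map (aemeasurable_surplusSup hlam)

lemma surplusSupLaw_nonneg [IsProbabilityMeasure G] (hlam : 0 < lam) :
    ∀ᵐ x ∂surplusSupLaw lam G, 0 ≤ x := by
  rw [surplusSupLaw, ae_map_iff (aemeasurable_surplusSup hlam) measurableSet_Ici]
  filter_upwards [ae_waiting_pos hlam] with ω hω
  rw [surplusSup_eq_iSup_surplusWalk hω]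
  exact iSup_surplusWalk_nonneg

/-- The increments of the embedded walk are independent and identically distributed, so its
exponential moments are powers of that of one increment. -/
lemma lintegral_exp_surplusWalk [IsProbabilityMeasure G] (hlam : 0 < lam) {γ : ℝ} (hγ : 0 ≤ γ)
    (n : ℕ) :
    ∫⁻ ω, ENNReal.ofReal (Real.exp (γ * surplusWalk ω n)) ∂riskMeasure lam G =
      (ENNReal.ofReal (lam / (lam + γ)) * ∫⁻ x, ENNReal.ofReal (Real.exp (γ * x)) ∂G) ^ n := by
  have := isProbabilityMeasure_expMeasure hlam
  have hmeas : Measurable fun p : ℝ × ℝ => ENNReal.ofReal (Real.exp (γ * (p.2 - p.1))) := by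
    fun_prop
  have hprod (ω : ℕ → ℝ × ℝ) : ENNReal.ofReal (Real.exp (γ * surplusWalk ω n)) =
      ∏ i ∈ Finset.range n, ENNReal.ofReal (Real.exp (γ * ((ω i).2 - (ω i).1))) := by
    rw [surplusWalk, Finset.mul_sum, Real.exp_sum,
      ENNReal.ofReal_prod_of_nonneg fun i _ => (Real.exp_pos _).le]
  have hone (i : ℕ) : ∫⁻ ω, ENNReal.ofReal (Real.exp (γ * ((ω i).2 - (ω i).1)))
      ∂riskMeasure lam G =
        ENNReal.ofReal (lam / (lam + γ)) * ∫⁻ x, ENNReal.ofReal (Real.exp (γ * x)) ∂G := by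
    rw [riskMeasure, (measurePreserving_eval_infinitePi
      (fun _ : ℕ => (expMeasure lam).prod G) i).lintegral_comp hmeas,
      ← lintegral_exp_neg_expMeasure hlam hγ, ← lintegral_prod_mul (by fun_prop) (by fun_prop)]
    refine lintegral_congr fun p => ?_
    rw [← ENNReal.ofReal_mul (Real.exp_pos _).le, ← Real.exp_add]
    ring_nf
  simp_rw [hprod]
  rw [lintegral_prod_eq_prod_lintegral_of_indepFun (μ := riskMeasure lam G) _
    (fun i (ω : ℕ → ℝ × ℝ) => ENNReal.ofReal (Real.exp (γ * ((ω i).2 - (ω i).1))))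
    (iIndepFun_infinitePi fun _ => hmeas) fun i => hmeas.comp (measurable_pi_apply i)]
  simp [hone]

lemma lintegral_tsum_exp_surplusWalk_lt_top [IsProbabilityMeasure G] (hlam : 0 < lam) {γ : ℝ}
    (hγ : 0 < γ) (hint : Integrable (fun x => Real.exp (γ * x)) G)
    (hlt : ∫ x, Real.exp (γ * x) ∂G < 1 + lam⁻¹ * γ) :
    ∫⁻ ω, ∑' n, ENNReal.ofReal (Real.exp (γ * surplusWalk ω n)) ∂riskMeasure lam G < ⊤ := by
  rw [lintegral_tsum fun n => by have := measurable_surplusWalk n; fun_prop]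
  simp_rw [lintegral_exp_surplusWalk hlam hγ.le]
  rw [ENNReal.tsum_geometric, ENNReal.inv_lt_top, tsub_pos_iff_lt,
    ← ofReal_integral_eq_lintegral_ofReal hint (Eventually.of_forall fun x => (Real.exp_pos _).le),
    ← ENNReal.ofReal_mul (by positivity), ENNReal.ofReal_lt_one]
  rw [div_mul_eq_mul_div, div_lt_one (by positivity)]
  calc _ < lam * (1 + lam⁻¹ * γ) := by gcongr
    _ = lam + γ := by field_simp

lemma bddAbove_claimSurplus [IsProbabilityMeasure G] (hlam : 0 < lam) {γ : ℝ}
    (hγ : 0 < γ) (hint : Integrable (fun x => Real.exp (γ * x)) G)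
    (hlt : ∫ x, Real.exp (γ * x) ∂G < 1 + lam⁻¹ * γ) :
    ∀ᵐ ω ∂riskMeasure lam G, BddAbove (Set.range fun t : NNReal => claimSurplus ω (t : ℝ)) := by
  have hmeas : Measurable fun ω => ∑' n, ENNReal.ofReal (Real.exp (γ * surplusWalk ω n)) :=
    Measurable.tsum fun n => by have := measurable_surplusWalk n; fun_prop
  filter_upwards [ae_waiting_pos hlam,
    ae_lt_top hmeas (lintegral_tsum_exp_surplusWalk_lt_top hlam hγ hint hlt).ne] with ω hω hfin
  refine ⟨Real.log (∑' n, ENNReal.ofReal (Real.exp (γ * surplusWalk ω n))).toReal / γ, ?_⟩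
  rintro _ ⟨t, rfl⟩
  exact (claimSurplus_le_surplusWalk hω t.2).trans (surplusWalk_le_of_tsum_ne_top hγ hfin.ne _)

/-- A Chernoff bound summed over all claims: the supremum of the surplus is light-tailed. -/
lemma integrable_exp_surplusSupLaw [IsProbabilityMeasure G] (hlam : 0 < lam) {γ : ℝ}
    (hγ : 0 < γ) (hint : Integrable (fun x => Real.exp (γ * x)) G)
    (hlt : ∫ x, Real.exp (γ * x) ∂G < 1 + lam⁻¹ * γ) :
    Integrable (fun x => Real.exp (γ * x)) (surplusSupLaw lam G) := by
  refine ⟨by fun_prop, ?_⟩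
  rw [hasFiniteIntegral_iff_ofReal (Eventually.of_forall fun x => (Real.exp_pos _).le),
    surplusSupLaw, lintegral_map' (by fun_prop) (aemeasurable_surplusSup hlam)]
  refine (lintegral_mono_ae ((ae_waiting_pos hlam).mono fun ω hω => ?_)).trans_lt
    (lintegral_tsum_exp_surplusWalk_lt_top hlam hγ hint hlt)
  rw [surplusSup_eq_iSup_surplusWalk hω]
  exact exp_iSup_surplusWalk_le hγ

end RiskModel

/-! ### Tails of subexponential distributions -/

lemma conv_real_Ioi (μ ν : Measure ℝ) [IsProbabilityMeasure μ] [IsProbabilityMeasure ν] (u : ℝ) :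
    (μ.conv ν).real (Set.Ioi u) = ∫ x, ν.real (Set.Ioi (u - x)) ∂μ := by
  have hmeas : Measurable fun x => ν (Set.Ioi (u - x)) :=
    Monotone.measurable fun a b hab => measure_mono (Set.Ioi_subset_Ioi (by linarith))
  have h : (μ.conv ν) (Set.Ioi u) = ∫⁻ x, ν (Set.Ioi (u - x)) ∂μ := by
    rw [← lintegral_indicator_one measurableSet_Ioi,
      Measure.lintegral_conv (measurable_one.indicator measurableSet_Ioi)]
    refine lintegral_congr fun x => ?_
    rw [← lintegral_indicator_one measurableSet_Ioi]
    refine lintegral_congr fun y => ?_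
    simp [Set.indicator_apply, sub_lt_iff_lt_add']
  rw [measureReal_def, h, ← integral_toReal hmeas.aemeasurable
    (Eventually.of_forall fun x => measure_lt_top _ _)]
  rfl

lemma conv_nonneg {μ ν : Measure ℝ} [SFinite ν] (hμ : ∀ᵐ x ∂μ, 0 ≤ x) (hν : ∀ᵐ x ∂ν, 0 ≤ x) :
    ∀ᵐ x ∂μ.conv ν, 0 ≤ x := by
  rw [Measure.conv, ae_map_iff (by fun_prop) measurableSet_Ici]
  filter_upwards [Measure.quasiMeasurePreserving_fst.ae hμ,
    Measure.quasiMeasurePreserving_snd.ae hν] with p h1 h2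
  exact add_nonneg h1 h2

lemma integrable_exp_conv {μ ν : Measure ℝ} [SFinite μ] [SFinite ν] {γ : ℝ}
    (hμ : Integrable (fun x => Real.exp (γ * x)) μ)
    (hν : Integrable (fun x => Real.exp (γ * x)) ν) :
    Integrable (fun x => Real.exp (γ * x)) (μ.conv ν) := by
  rw [Measure.conv, integrable_map_measure (by fun_prop) (by fun_prop)]
  refine (hμ.mul_prod hν).congr (Eventually.of_forall fun p => ?_)
  simp [mul_add, Real.exp_add]

section Subexponential

variable {F : Measure ℝ}

lemma IsSubexponential.nonneg (hF : IsSubexponential F) : ∀ᵐ x ∂F, 0 ≤ x := by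
  rw [ae_iff]; simpa [not_le, Set.Iio] using hF.2.1

/-- The ratio of the tail to itself tends to one, so the tail cannot vanish. -/
lemma IsSubexponential.tail_pos (hF : IsSubexponential F) (u : ℝ) :
    0 < F.real (Set.Ioi u) := by
  have : IsProbabilityMeasure F := hF.1
  have h := hF.2.2 1 le_rfl
  obtain ⟨v, hv, huv⟩ := ((h.eventually_ne (by norm_num : ((1 : ℕ) : ℝ) ≠ 0)).and
    (eventually_ge_atTop u)).exists
  have hv' : F.real (Set.Ioi v) ≠ 0 := fun h0 => hv (by rw [h0, div_zero])
  exact (lt_of_le_of_ne measureReal_nonneg hv'.symm).trans_le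
    (measureReal_mono (Set.Ioi_subset_Ioi huv))

lemma IsSubexponential.tendsto_conv_self (hF : IsSubexponential F) :
    Tendsto (fun u : ℝ => (F.conv F).real (Set.Ioi u) / F.real (Set.Ioi u)) atTop (𝓝 2) := by
  have : IsProbabilityMeasure F := hF.1
  have h := hF.2.2 2 (by norm_num)
  simpa [convPower] using h

/-- Splitting the first summand at `y` and at `u`. -/
lemma conv_self_real_Ioi_ge [IsProbabilityMeasure F] (hF : ∀ᵐ x ∂F, 0 ≤ x) {y u : ℝ}
    (hyu : y ≤ u) :
    F.real (Set.Iic y) * F.real (Set.Ioi u) +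
      F.real (Set.Ioc y u) * F.real (Set.Ioi (u - y)) + F.real (Set.Ioi u) ≤
      (F.conv F).real (Set.Ioi u) := by
  have hone (v : ℝ) (hv : v < 0) : F.real (Set.Ioi v) = 1 := by
    rw [measureReal_def, prob_compl_eq_zero_iff measurableSet_Ioi |>.1 ?_]
    · simp
    · rw [Set.compl_Ioi]
      exact measure_mono_null (fun x (hx : x ≤ v) => not_le.2 (hx.trans_lt hv)) (ae_iff.1 hF)
  have hmono : Monotone fun x => F.real (Set.Ioi (u - x)) := fun a b hab =>
    measureReal_mono (Set.Ioi_subset_Ioi (by linarith))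
  have hint : Integrable (fun x => F.real (Set.Ioi (u - x))) F :=
    Integrable.of_bound hmono.measurable.aestronglyMeasurable 1
      (Eventually.of_forall fun x => by
        rw [Real.norm_eq_abs, abs_of_nonneg measureReal_nonneg]; exact measureReal_le_one)
  have hind (s : Set ℝ) (hs : MeasurableSet s) (c : ℝ) :
      ∫ x, s.indicator (fun _ => c) x ∂F = F.real s * c := by
    rw [integral_indicator_const _ hs, smul_eq_mul]
  have hii (s : Set ℝ) (hs : MeasurableSet s) (c : ℝ) :
      Integrable (s.indicator (fun _ => c)) F := (integrable_const c).indicator hs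
  have hlast : F.real (Set.Ioi u) = ∫ x, (Set.Ioi u).indicator (fun _ => (1 : ℝ)) x ∂F := by
    rw [hind _ measurableSet_Ioi, mul_one]
  rw [conv_real_Ioi]
  nth_rewrite 2 [hlast]
  rw [← hind _ measurableSet_Iic, ← hind _ measurableSet_Ioc,
    ← integral_add' (hii _ measurableSet_Iic _) (hii _ measurableSet_Ioc _),
    ← integral_add' ((hii _ measurableSet_Iic _).add (hii _ measurableSet_Ioc _))
      (hii _ measurableSet_Ioi _)]
  refine integral_mono_ae (((hii _ measurableSet_Iic _).add (hii _ measurableSet_Ioc _)).add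
      (hii _ measurableSet_Ioi _)) hint (hF.mono fun x hx => ?_)
  simp only [Set.indicator_apply, Set.mem_Iic, Set.mem_Ioc, Set.mem_Ioi, Pi.add_apply]
  rcases le_or_gt x y with h1 | h1
  · rw [if_pos h1, if_neg (by simp [h1]), if_neg (by linarith)]
    simpa using hmono hx
  · rcases le_or_gt x u with h2 | h2
    · rw [if_neg (by linarith), if_pos ⟨h1, h2⟩, if_neg (by linarith)]
      simpa using hmono h1.le
    · rw [if_neg (by linarith), if_neg (by simp [h2]), if_pos h2]
      simpa using (hone (u - x) (by linarith)).ge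

/-- Subexponential distributions are long-tailed. -/
lemma IsSubexponential.tendsto_shift (hF : IsSubexponential F) {y : ℝ} (hy : 0 ≤ y) :
    Tendsto (fun u : ℝ => F.real (Set.Ioi (u - y)) / F.real (Set.Ioi u)) atTop (𝓝 1) := by
  have : IsProbabilityMeasure F := hF.1
  have hcompl (v : ℝ) : F.real (Set.Iic v) = 1 - F.real (Set.Ioi v) := by
    rw [← Set.compl_Ioi, probReal_compl_eq_one_sub measurableSet_Ioi]
  have htail : Tendsto (fun u => F.real (Set.Ioi u)) atTop (𝓝 0) := by
    have h := (tendsto_cdf_atTop F).const_sub 1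
    rw [sub_self] at h
    exact h.congr fun u => by rw [cdf_eq_real, hcompl]; ring
  have hpos := hF.tail_pos
  have hup : Tendsto (fun u => ((F.conv F).real (Set.Ioi u) / F.real (Set.Ioi u) - 1 -
      F.real (Set.Iic y)) / (F.real (Set.Ioi y) - F.real (Set.Ioi u))) atTop (𝓝 1) := by
    have h := ((hF.tendsto_conv_self.sub_const 1).sub_const (F.real (Set.Iic y))).div
      (htail.const_sub (F.real (Set.Ioi y))) (by simpa using (hpos y).ne')
    convert h using 1
    congr 1
    have := (hpos y).ne'
    rw [hcompl, sub_zero, show 2 - 1 - (1 - F.real (Set.Ioi y)) = F.real (Set.Ioi y) by ring,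
      div_self this]
  refine tendsto_of_tendsto_of_tendsto_of_le_of_le' tendsto_const_nhds hup
    (Eventually.of_forall fun u => ?_) ?_
  · rw [one_le_div (hpos u)]
    exact measureReal_mono (Set.Ioi_subset_Ioi (by linarith))
  · filter_upwards [eventually_ge_atTop y, htail.eventually_lt_const (hpos y)] with u hu hlt
    have h := conv_self_real_Ioi_ge hF.nonneg hu
    have hIoc : F.real (Set.Ioc y u) = F.real (Set.Ioi y) - F.real (Set.Ioi u) := by
      have := measureReal_sdiff (μ := F) (Set.Ioi_subset_Ioi hu) measurableSet_Ioi
      rwa [Set.Ioi_sdiff_Ioi] at this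
    rw [hIoc] at h
    rw [le_div_iff₀ (by linarith), ← sub_nonneg]
    have : (F.conv F).real (Set.Ioi u) / F.real (Set.Ioi u) - 1 - F.real (Set.Iic y) -
        F.real (Set.Ioi (u - y)) / F.real (Set.Ioi u) * (F.real (Set.Ioi y) - F.real (Set.Ioi u)) =
        ((F.conv F).real (Set.Ioi u) - (F.real (Set.Iic y) * F.real (Set.Ioi u) +
          (F.real (Set.Ioi y) - F.real (Set.Ioi u)) * F.real (Set.Ioi (u - y)) +
          F.real (Set.Ioi u))) / F.real (Set.Ioi u) := by
      have := (hpos u).ne'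
      field_simp
      ring
    rw [this]
    exact div_nonneg (by linarith) (hpos u).le

/-- A Potter-type bound: lowering the level of a subexponential tail by `t` costs at most an
arbitrarily small exponential in `t`, uniformly in the level. -/
lemma IsSubexponential.exists_tail_le (hF : IsSubexponential F) {γ : ℝ} (hγ : 0 < γ) :
    ∃ K : ℝ, 0 < K ∧ ∀ v t : ℝ, 0 ≤ t →
      F.real (Set.Ioi v) ≤ K * Real.exp (γ * t) * F.real (Set.Ioi (v + t)) := by
  have : IsProbabilityMeasure F := hF.1
  have hpos := hF.tail_pos
  have hanti {a b : ℝ} (h : a ≤ b) : F.real (Set.Ioi b) ≤ F.real (Set.Ioi a) :=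
    measureReal_mono (Set.Ioi_subset_Ioi h)
  obtain ⟨u₀, hu₀⟩ := eventually_atTop.1
    ((hF.tendsto_shift zero_le_one).eventually_le_const (Real.one_lt_exp_iff.2 hγ))
  have hstep (v : ℝ) (hv : u₀ ≤ v) :
      F.real (Set.Ioi v) ≤ Real.exp γ * F.real (Set.Ioi (v + 1)) := by
    have := hu₀ (v + 1) (by linarith)
    rwa [div_le_iff₀ (hpos _), add_sub_cancel_right] at this
  have hnat (v : ℝ) (hv : u₀ ≤ v) (n : ℕ) :
      F.real (Set.Ioi v) ≤ Real.exp (γ * n) * F.real (Set.Ioi (v + n)) := by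
    induction n with
    | zero => simp
    | succ n ih =>
      refine ih.trans ?_
      have := hstep (v + n) (by linarith [n.cast_nonneg (α := ℝ)])
      calc _ ≤ Real.exp (γ * n) * (Real.exp γ * F.real (Set.Ioi (v + n + 1))) := by gcongr
        _ = _ := by
          push_cast
          rw [← mul_assoc, ← Real.exp_add, mul_add, mul_one, add_assoc]
  have hreal (v : ℝ) (hv : u₀ ≤ v) (t : ℝ) (ht : 0 ≤ t) :
      F.real (Set.Ioi v) ≤ Real.exp γ * Real.exp (γ * t) * F.real (Set.Ioi (v + t)) := by
    refine (hnat v hv ⌈t⌉₊).trans ?_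
    rw [← Real.exp_add]
    refine mul_le_mul (Real.exp_le_exp.2 ?_) (hanti (by linarith [Nat.le_ceil t]))
      measureReal_nonneg (Real.exp_pos _).le
    nlinarith [Nat.ceil_lt_add_one ht]
  have hone : F.real (Set.Ioi u₀) ≤ 1 := measureReal_le_one
  refine ⟨Real.exp γ / F.real (Set.Ioi u₀), by have := hpos u₀; positivity, fun v t ht => ?_⟩
  rw [div_mul_eq_mul_div, div_mul_eq_mul_div, le_div_iff₀ (hpos u₀)]
  rcases le_total u₀ v with hv | hv
  · exact (mul_le_of_le_one_right measureReal_nonneg hone).trans (hreal v hv t ht)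
  · refine (mul_le_of_le_one_left (hpos u₀).le measureReal_le_one).trans
      ((hreal u₀ le_rfl t ht).trans ?_)
    exact mul_le_mul_of_nonneg_left (hanti (by linarith)) (by positivity)

/-- Adding an independent nonnegative light-tailed variable does not change a subexponential
tail. -/
lemma IsSubexponential.tendsto_conv_light (hF : IsSubexponential F) {H : Measure ℝ}
    [IsProbabilityMeasure H] (hH : ∀ᵐ x ∂H, 0 ≤ x) {γ : ℝ} (hγ : 0 < γ)
    (hint : Integrable (fun x => Real.exp (γ * x)) H) :
    Tendsto (fun u : ℝ => (H.conv F).real (Set.Ioi u) / F.real (Set.Ioi u)) atTop (𝓝 1) := by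
  have : IsProbabilityMeasure F := hF.1
  obtain ⟨K, -, hK⟩ := hF.exists_tail_le hγ
  have hmono (u : ℝ) : Monotone fun x => F.real (Set.Ioi (u - x)) := fun a b hab =>
    measureReal_mono (Set.Ioi_subset_Ioi (by linarith))
  have h := tendsto_integral_filter_of_dominated_convergence (μ := H) (l := atTop)
    (F := fun u x => F.real (Set.Ioi (u - x)) / F.real (Set.Ioi u)) (f := fun _ => 1)
    (fun x => K * Real.exp (γ * x))
    (Eventually.of_forall fun u => ((hmono u).measurable.div_const _).aestronglyMeasurable)
    (Eventually.of_forall fun u => hH.mono fun x hx => by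
      rw [Real.norm_eq_abs, abs_of_nonneg (by positivity), div_le_iff₀ (hF.tail_pos u)]
      simpa using hK (u - x) x hx)
    (hint.const_mul K) (hH.mono fun x hx => hF.tendsto_shift hx)
  simp only [integral_const, probReal_univ, smul_eq_mul, mul_one] at h
  refine h.congr fun u => ?_
  rw [conv_real_Ioi, integral_div]

/-- A light tail is negligible compared to a subexponential one. -/
lemma IsSubexponential.tendsto_light_div (hF : IsSubexponential F) {H : Measure ℝ}
    [IsProbabilityMeasure H] {γ : ℝ} (hγ : 0 < γ)
    (hint : Integrable (fun x => Real.exp (γ * x)) H) :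
    Tendsto (fun u : ℝ => H.real (Set.Ioi u) / F.real (Set.Ioi u)) atTop (𝓝 0) := by
  have : IsProbabilityMeasure F := hF.1
  obtain ⟨K, hK0, hK⟩ := hF.exists_tail_le (half_pos hγ)
  set E : ℝ := ∫ x, Real.exp (γ * x) ∂H with hE
  have h0 := hF.tail_pos 0
  have hH (u : ℝ) : H.real (Set.Ioi u) ≤ E * Real.exp (-(γ * u)) := by
    have h1 := mul_meas_ge_le_integral_of_nonneg (μ := H)
      (Eventually.of_forall fun x => (Real.exp_pos (γ * x)).le) hint (Real.exp (γ * u))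
    rw [Real.exp_neg, ← div_eq_mul_inv, le_div_iff₀ (Real.exp_pos _), mul_comm]
    refine le_trans ?_ h1
    gcongr
    · exact measure_ne_top _ _
    · intro x (hx : u < x)
      exact Real.exp_le_exp.2 (by gcongr)
  have hlim : Tendsto (fun u : ℝ => E * K / F.real (Set.Ioi 0) * Real.exp (-(γ / 2 * u))) atTop
      (𝓝 0) := by
    have := (Real.tendsto_exp_neg_atTop_nhds_zero.comp
      (tendsto_id.const_mul_atTop (half_pos hγ))).const_mul (E * K / F.real (Set.Ioi 0))
    simpa using this
  refine squeeze_zero' (Eventually.of_forall fun u => by positivity) ?_ hlim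
  filter_upwards [eventually_ge_atTop 0] with u hu
  have h1 := hK 0 u hu
  rw [zero_add] at h1
  have hE0 : 0 ≤ E := integral_nonneg fun x => (Real.exp_pos _).le
  rw [div_le_iff₀ (hF.tail_pos u)]
  calc H.real (Set.Ioi u) ≤ E * Real.exp (-(γ * u)) := hH u
    _ = E * Real.exp (-(γ * u)) / F.real (Set.Ioi 0) * F.real (Set.Ioi 0) := by
      field_simp
    _ ≤ E * Real.exp (-(γ * u)) / F.real (Set.Ioi 0) *
        (K * Real.exp (γ / 2 * u) * F.real (Set.Ioi u)) := by gcongr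
    _ = E * K / F.real (Set.Ioi 0) * (Real.exp (-(γ * u)) * Real.exp (γ / 2 * u)) *
        F.real (Set.Ioi u) := by ring
    _ = _ := by
      rw [← Real.exp_add]
      ring_nf

end Subexponential

/-! ### Asymptotics of the corrected discard approximation -/

theorem theoremt (lam eps δ θ : ℝ) (B C : Measure ℝ)
    (hlam : 0 < lam) (heps : 0 < eps) (heps1 : eps ≤ 1)
    (hB : IsPhaseType B)
    (hC : IsProbabilityMeasure C) (hC0 : C (Set.Iio 0) = 0)
    (hCint : Integrable (fun x : ℝ => x) C) (hCpos : 0 < ∫ x, x ∂C)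
    (hδ : δ = lam * ∫ x, x ∂B) (hθ : θ = lam * ∫ x, x ∂C)
    (hstab : (1 - eps) * δ + eps * θ < 1)
    (hS : IsSubexponential (stationaryExcess C)) :
    -- the supremum in the definition of the discard approximation is almost surely finite
    (∀ᵐ ω ∂riskMeasure lam (discardClaim eps B),
      BddAbove (Set.range fun t : NNReal => claimSurplus ω (t : ℝ))) ∧
    -- the tail asymptotics
    Tendsto
      (fun u : ℝ => correctedDiscard lam eps B C u /
        (eps * θ / (1 - δ + eps * δ) * (stationaryExcess C).real (Set.Ioi u)))
      atTop (𝓝 1) ∧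
    -- comparison with the coefficient in the tail of the exact ruin probability
    0 < eps * θ / (1 - δ + eps * δ) ∧
    eps * θ / (1 - δ + eps * δ) < eps * θ / (1 - δ + eps * δ - eps * θ) := by
  have hθ0 : 0 < eps * θ := by rw [hθ]; positivity
  have hden' : 0 < 1 - δ + eps * δ - eps * θ := by linarith
  have hden : 0 < 1 - δ + eps * δ := by linarith
  have hc : 0 < eps * θ / (1 - δ + eps * δ) := div_pos hθ0 hden
  have : IsProbabilityMeasure B := hB.1
  have : IsProbabilityMeasure (discardClaim eps B) :=
    isProbabilityMeasure_discardClaim heps.le heps1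
  have hBnn : ∀ᵐ x ∂B, 0 ≤ x := by
    rw [ae_iff]; simpa [not_le, Set.Iio] using hB.2.1
  obtain ⟨s, hs, hBexp⟩ := hB.exists_integrable_exp
  have hBint : Integrable (fun x => x) B := by
    refine (hBexp.const_mul s⁻¹).mono' (by fun_prop) (hBnn.mono fun x hx => ?_)
    rw [Real.norm_eq_abs, abs_of_nonneg hx, ← div_eq_inv_mul, le_div_iff₀ hs, mul_comm]
    linarith [Real.add_one_le_exp (s * x)]
  -- The stability condition says that the mean discarded claim is below the mean waiting time.
  have hmean : ∫ x, x ∂discardClaim eps B < lam⁻¹ := by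
    rw [integral_discardClaim hBint heps.le heps1, mul_zero, add_zero, ← one_div,
      lt_div_iff₀ hlam]
    have : (1 - eps) * (∫ x, x ∂B) * lam = (1 - eps) * δ := by rw [hδ]; ring
    linarith
  obtain ⟨γ, hγ, hGexp, hGlt⟩ := exists_integral_exp_lt (discardClaim_nonneg hB.2.1) hs
    (integrable_discardClaim hBexp) hmean
  refine ⟨bddAbove_claimSurplus hlam hγ hGexp hGlt, ?_, hc,
    div_lt_div_of_pos_left hθ0 hden' (by linarith)⟩
  set M := surplusSupLaw lam (discardClaim eps B) with hM
  set F := stationaryExcess C with hF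
  have : IsProbabilityMeasure M := isProbabilityMeasure_surplusSupLaw hlam
  have hMnn : ∀ᵐ x ∂M, 0 ≤ x := surplusSupLaw_nonneg hlam
  have hMexp : Integrable (fun x => Real.exp (γ * x)) M :=
    integrable_exp_surplusSupLaw hlam hγ hGexp hGlt
  have h1 := hS.tendsto_light_div hγ hMexp
  have h2 := hS.tendsto_conv_light (conv_nonneg hMnn hMnn) hγ (integrable_exp_conv hMexp hMexp)
  have h3 : Tendsto (fun u => M.real (Set.Ioi u) / F.real (Set.Ioi u) /
      (eps * θ / (1 - δ + eps * δ)) + (((M.conv M).conv F).real (Set.Ioi u) / F.real (Set.Ioi u) -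
        M.real (Set.Ioi u) / F.real (Set.Ioi u))) atTop (𝓝 1) := by
    simpa using (h1.div_const (eps * θ / (1 - δ + eps * δ))).add (h2.sub h1)
  refine h3.congr fun u => ?_
  have hFu := (hS.tail_pos u).ne'
  simp only [correctedDiscard, discardApprox, ← hδ, ← hθ, ← hM, ← hF]
  generalize eps * θ / (1 - δ + eps * δ) = c at hc
  have hc' := hc.ne'
  field_simp
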